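/- Theorem (distance distribution of the planar flight with Poisson deviations reflected in a circle). Let $c,\lambda,R>0$. Let $V_1,V_2,\dots$ be independent random vectors uniformly distributed on the unit circle of $\mathbb R^2$ and, independently of them, let $0=t_0<t_1<t_2<\cdots$ with $t_k=\tau_1+\dots+\tau_k$ be the event times of a homogeneous Poisson process of rate $\lambda$ (so the $\tau_k$ are independent and exponential with parameter $\lambda$), and let $N(t)=\max\{k\ge 0: t_k\le t\}$. The free planar flight of speed $c$ is $$X(t)=c\Big(\sum_{k=1}^{N(t)}\tau_kV_k+\big(t-t_{N(t)}\big)V_{N(t)+1}\Big).$$ With the circular inversion $\mu_R(x)=R^2x/\|x\|^2$, the flight reflected in the circle of radius $R$ about the origin is $X^*(t)=X(t)$ if $t\le R/c$, and for $t>R/c$ it is $X^*(t)=X(t)$ if $\|X(t)\|<R$ and $X^*(t)=\mu_R(X(t))$ if $R\le\|X(t)\|\le ct$. Let $D_2^*(t)=\|X^*(t)\|$. Then for all $t>R/c$ and $0<r\le R$, $$P\{D_2^*(t)<r\}=1-\exp\Big\{-\lambda t+\frac{\lambda}{c}\sqrt{c^2t^2-r^2}\Big\}+\exp\Big\{-\lambda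 t+\frac{\lambda}{c}\sqrt{c^2t^2-\frac{R^4}{r^2}}\Big\}\,\mathbf 1_{(R^2/(ct),\,R]}(r).$$ -/

import Mathlib

open MeasureTheory ProbabilityTheory
open scoped ENNReal

noncomputable section

namespace RandomFlight

/-- The Euclidean plane. -/
abbrev Plane : Type := EuclideanSpace ℝ (Fin 2)

/-- The uniform distribution on the unit circle: the law of `(sin φ, cos φ)` where the angle `φ` has
density `1 / (2π)` on `[0, 2π]`. -/
def uniformCircle : Measure Plane :=
  Measure.map (fun φ : ℝ => (!₂[Real.sin φ, Real.cos φ] : Plane))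
    (ENNReal.ofReal (2 * Real.pi)⁻¹ • volume.restrict (Set.Icc 0 (2 * Real.pi)))

variable {Ω : Type*}

/-- The instant of the `n`-th change of direction (with value `0` for `n = 0`). Here `τ k` is the time
between the `k`-th and the `(k + 1)`-st of these instants. -/
def changeTime (τ : ℕ → Ω → ℝ) (n : ℕ) (ω : Ω) : ℝ :=
  ∑ k ∈ Finset.range n, τ k ω

/-- The number of changes of direction up to time `t`: the largest `n` whose instant is at most `t`. -/
def numChanges (τ : ℕ → Ω → ℝ) (t : ℝ) (ω : Ω) : ℕ :=
  sSup {n : ℕ | changeTime τ n ω ≤ t}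

/-- The position at time `t` of the free flight with speed `c`: it starts at the origin and moves in the
direction `V k` between the `k`-th and the `(k + 1)`-st change instants. The last displacement, which is
still in progress at time `t`, has lasted for the time elapsed since the last change of direction. -/
def freeFlight (c : ℝ) (V : ℕ → Ω → Plane) (τ : ℕ → Ω → ℝ) (t : ℝ) (ω : Ω) : Plane :=
  c • (∑ k ∈ Finset.range (numChanges τ t ω), τ k ω • V k ω
    + (t - changeTime τ (numChanges τ t ω) ω) • V (numChanges τ t ω) ω)

open Classical in
/-- The flight reflected in the circle of radius `R` about the origin by circular inversion
`x ↦ (R² / ‖x‖²) x`. -/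
def reflectedFlight (c R : ℝ) (V : ℕ → Ω → Plane) (τ : ℕ → Ω → ℝ) (t : ℝ) (ω : Ω) : Plane :=
  if t ≤ R / c then
    freeFlight c V τ t ω
  else if numChanges τ t ω = 0 then
    Set.indicator (Metric.sphere (0 : Plane) (c * t)) (EuclideanGeometry.inversion 0 R)
      (freeFlight c V τ t ω)
  else
    Set.indicator (Metric.ball (0 : Plane) R) id (freeFlight c V τ t ω)
      + Set.indicator {x : Plane | R ≤ ‖x‖ ∧ ‖x‖ ≤ c * t} (EuclideanGeometry.inversion 0 R)
        (freeFlight c V τ t ω)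

/-- The distance of the reflected flight from the origin. -/
def reflectedDistance (c R : ℝ) (V : ℕ → Ω → Plane) (τ : ℕ → Ω → ℝ) (t : ℝ) (ω : Ω) : ℝ :=
  ‖reflectedFlight c R V τ t ω‖

/-- The probabilistic assumptions on the directions `V 0, V 1, …` and on the times `τ 0, τ 1, …` between
changes of direction: the directions are independent and uniform on the unit circle; the changes of
direction happen at the events of a homogeneous Poisson process of rate `lam`, i.e. the times between
them are independent and exponential of parameter `lam`; the two sequences are independent. -/
structure IsPoissonFlight [MeasurableSpace Ω] (P : Measure Ω) (lam : ℝ)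
    (V : ℕ → Ω → Plane) (τ : ℕ → Ω → ℝ) : Prop where
  hasLaw_direction : ∀ k, HasLaw (V k) uniformCircle P
  hasLaw_time : ∀ k, HasLaw (τ k) (expMeasure lam) P
  iIndepFun_direction : iIndepFun V P
  iIndepFun_time : iIndepFun τ P
  indepFun : IndepFun (fun ω k => V k ω) (fun ω k => τ k ω) P

end RandomFlight

end

/-!
The free flight is studied first. Let `E_n` be the event of exactly `n` changes of direction up to
time `t`. For `n ≥ 1` the position on `E_n` has the density
`(λ / c) ^ n / ((n - 1)! 2π) * exp (-λ t) * (c² t² - ‖x‖²) ^ (n / 2 - 1)` on the disc of radius `c t`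
(`flightExpectation_succ_eq`), and on `E_0` it is uniform on the bounding circle with total mass
`exp (-λ t)`. Integrating over `s < ‖x‖` gives
`exp (-λ t) * ((λ / c) √(c² t² - s²)) ^ n / n!` for every `n`, and the sum over `n` is the
exponential `exp (-λ t + (λ / c) √(c² t² - s²))`.

The density is found by induction on `n` from the renewal equation `flightExpectation_succ`, which
conditions on the first waiting time and the first direction. If the first displacement is `a • v`
with `‖v‖ = 1`, then for `L = c t`
`(L - a)² - ‖x - a • v‖² = (L² - ‖x‖²) - 2 (L - ⟪x, v⟫) a`
is affine in `a`, so the integral over `a` is elementary and leaves a factor `1 / (L - ⟪x, v⟫)`.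
Its average over the circle is the integral of a Poisson kernel, equal to `1 / √(L² - ‖x‖²)`
(`lintegral_one_div_sub_inner`); hence one further displacement raises the exponent by one half
(`lintegral_profile_step`). The induction starts at `n = 1` (`lintegral_two_steps`), where two
singular laws are convolved: in polar coordinates centred at `L • w` the points `a • v + (L - a) • w`
become explicit, with the angle of `v` running at twice the speed of the polar angle, and the same
Poisson kernel appears.

For the reflected flight, inversion turns the condition `R² / ‖x‖ < r` into `R² / r < ‖x‖`. Since
`r ≤ R ≤ R² / r`, the event of distance less than `r` is almost surely the disjoint union of
`‖X‖ < r` and `R² / r < ‖X‖`, and the second one is null unless `R² / r < c t`.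
-/

namespace RandomFlight

open Set Real
open scoped RealInnerProductSpace

/-! ### Integration tools, the unit circle and polar coordinates -/

theorem setLIntegral_Ioo_deriv_of_nonneg {g g' : ℝ → ℝ} {a b : ℝ} (hab : a ≤ b)
    (hcont : ContinuousOn g (Icc a b)) (hderiv : ∀ x ∈ Ioo a b, HasDerivAt g (g' x) x)
    (hpos : ∀ x ∈ Ioo a b, 0 ≤ g' x) :
    ∫⁻ x in Ioo a b, ENNReal.ofReal (g' x) = ENNReal.ofReal (g b - g a) := by
  have hint := intervalIntegral.integrableOn_deriv_of_nonneg hcont hderiv hpos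
  rw [← intervalIntegral.integral_eq_sub_of_hasDerivAt_of_le hab hcont hderiv
    ((intervalIntegrable_iff_integrableOn_Ioc_of_le hab).2 hint),
    intervalIntegral.integral_of_le hab, integral_Ioc_eq_integral_Ioo,
    ofReal_integral_eq_lintegral_ofReal (hint.mono_set Ioo_subset_Ioc_self)]
  exact (ae_restrict_iff' measurableSet_Ioo).2 (.of_forall hpos)

theorem _root_.Function.Periodic.setLIntegral_Ioc_add_eq {T : ℝ} (hT : 0 < T) {f : ℝ → ℝ≥0∞}
    (hf : Function.Periodic f T) (a b : ℝ) :
    ∫⁻ x in Ioc a (a + T), f x = ∫⁻ x in Ioc b (b + T), f x := by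
  refine (isAddFundamentalDomain_Ioc hT a).setLIntegral_eq (isAddFundamentalDomain_Ioc hT b) f ?_
  rintro ⟨g, hg⟩ x
  obtain ⟨n, rfl⟩ := AddSubgroup.mem_zmultiples_iff.1 hg
  simpa [AddSubgroup.vadd_def, add_comm] using hf.zsmul n x

theorem setLIntegral_comp_mul_add {k : ℝ} (hk : 0 < k) (b : ℝ) (s : Set ℝ) (g : ℝ → ℝ≥0∞) :
    ∫⁻ x in (fun x => k * x + b) ⁻¹' s, g (k * x + b) =
      ENNReal.ofReal k⁻¹ * ∫⁻ x in s, g x := by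
  have he : MeasurableEmbedding (fun x : ℝ => k * x + b) :=
    (measurableEmbedding_addRight b).comp (measurableEmbedding_mulLeft₀ hk.ne')
  have hmap : Measure.map (fun x : ℝ => k * x + b) volume = ENNReal.ofReal k⁻¹ • volume := by
    have h1 : Measure.map ((fun x : ℝ => x + b) ∘ fun x : ℝ => k * x) volume
        = ENNReal.ofReal k⁻¹ • volume := by
      rw [← Measure.map_map (by fun_prop) (by fun_prop), Real.map_volume_mul_left hk.ne',
        Measure.map_smul, map_add_right_eq_self, abs_of_pos (inv_pos.2 hk)]
    exact h1
  rw [← he.lintegral_map g, ← he.restrict_map, hmap, Measure.restrict_smul,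
    lintegral_smul_measure, smul_eq_mul]

/-- The unit vector at angle `φ`, measured clockwise from the second coordinate axis, as in
`uniformCircle`. -/
noncomputable def dir (φ : ℝ) : Plane := !₂[sin φ, cos φ]

@[simp] theorem dir_zero_coord (φ : ℝ) : dir φ 0 = sin φ := rfl
@[simp] theorem dir_one_coord (φ : ℝ) : dir φ 1 = cos φ := rfl

theorem inner_plane (x y : Plane) : ⟪x, y⟫ = x 0 * y 0 + x 1 * y 1 := by
  simp [PiLp.inner_apply, Fin.sum_univ_two, mul_comm]

theorem norm_sq_plane (x : Plane) : ‖x‖ ^ 2 = x 0 ^ 2 + x 1 ^ 2 := by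
  rw [← real_inner_self_eq_norm_sq, inner_plane]; ring

theorem inner_dir_dir (φ α : ℝ) : ⟪dir φ, dir α⟫ = cos (φ - α) := by
  rw [inner_plane, cos_sub]; simp; ring

@[simp] theorem norm_dir (φ : ℝ) : ‖dir φ‖ = 1 := by
  rw [← sq_eq_sq₀ (norm_nonneg _) zero_le_one, norm_sq_plane]; simp

@[fun_prop] theorem continuous_dir : Continuous dir := by
  unfold dir; fun_prop

@[fun_prop] theorem measurable_dir : Measurable dir := continuous_dir.measurable

theorem dir_periodic : Function.Periodic dir (2 * π) := fun φ => by simp [dir]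

theorem exists_norm_smul_dir (x : Plane) : ∃ α, x = ‖x‖ • dir α := by
  refine ⟨Complex.arg ⟨x 1, x 0⟩, ?_⟩
  have h : ‖x‖ = ‖(⟨x 1, x 0⟩ : ℂ)‖ := by
    rw [← sq_eq_sq₀ (norm_nonneg _) (norm_nonneg _), norm_sq_plane, Complex.sq_norm,
      Complex.normSq_apply]
    ring
  ext i
  rw [h]
  fin_cases i
  · simp
  · simp

theorem lintegral_uniformCircle {f : Plane → ℝ≥0∞} (hf : Measurable f) (a : ℝ) :
    ∫⁻ v, f v ∂uniformCircle
      = ENNReal.ofReal (2 * π)⁻¹ * ∫⁻ φ in Ioc a (a + 2 * π), f (dir φ) := by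
  rw [Function.Periodic.setLIntegral_Ioc_add_eq two_pi_pos (fun φ => by rw [dir_periodic φ]) a 0,
    zero_add]
  change ∫⁻ v, f v ∂(Measure.map dir _) = _
  rw [lintegral_map hf measurable_dir, lintegral_smul_measure, smul_eq_mul,
    setLIntegral_congr Ioc_ae_eq_Icc]

instance isProbabilityMeasure_uniformCircle : IsProbabilityMeasure uniformCircle := by
  constructor
  rw [← setLIntegral_one, setLIntegral_univ, lintegral_uniformCircle measurable_const 0]
  rw [lintegral_one, Measure.restrict_apply_univ, Real.volume_Ioc, zero_add, sub_zero,
    ← ENNReal.ofReal_mul (by positivity), inv_mul_cancel₀ (by positivity), ENNReal.ofReal_one]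

theorem ae_norm_eq_one_uniformCircle : ∀ᵐ v ∂uniformCircle, ‖v‖ = 1 := by
  refine (ae_map_iff (μ := _) (f := dir) measurable_dir.aemeasurable ?_).2 ?_
  · exact measurableSet_eq_fun (by fun_prop) (by fun_prop)
  · simp

/-- Integration in polar coordinates over an arbitrary angular period. -/
theorem lintegral_plane_polar {F : Plane → ℝ≥0∞} (hF : Measurable F) (a : ℝ) :
    ∫⁻ y, F y = ∫⁻ φ in Ioc a (a + 2 * π), ∫⁻ ρ in Ioi 0,
      ENNReal.ofReal ρ * F (ρ • dir φ) := by
  have hmp : MeasurePreserving (fun p : ℝ × ℝ => (!₂[p.2, p.1] : Plane)) :=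
    (PiLp.volume_preserving_toLp (Fin 2)).comp
      (((volume_preserving_finTwoArrow ℝ).symm _).comp Measure.measurePreserving_swap)
  rw [Function.Periodic.setLIntegral_Ioc_add_eq two_pi_pos
      (fun φ => by simp_rw [dir_periodic φ]) a (-π),
    ← hmp.lintegral_comp hF, ← lintegral_comp_polarCoord_symm]
  have hend : -π + 2 * π = π := by ring
  rw [hend, polarCoord_target, Measure.volume_eq_prod, ← Measure.prod_restrict,
    lintegral_prod_symm, restrict_Ioo_eq_restrict_Ioc]
  · refine lintegral_congr fun φ => lintegral_congr fun ρ => ?_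
    congr 2
    ext i
    fin_cases i <;> simp
  · have : Measurable fun p : ℝ × ℝ => polarCoord.symm p := continuous_polarCoord_symm.measurable
    have h2 := (hF.comp hmp.measurable).comp this
    exact ((measurable_fst.ennreal_ofReal).mul h2).aemeasurable

/-! ### The Poisson kernel and the radial profiles -/

/-- A primitive of `θ ↦ 1 / (a - b * cos θ)` that is smooth on the whole line, unlike the usual one
through `tan (θ / 2)`, which has jumps. -/
theorem hasDerivAt_poissonKernel_primitive {a b : ℝ} (hab : |b| < a) (θ : ℝ) :
    HasDerivAt (fun θ => (θ + 2 * arctan (b * sin θ / (a + √(a ^ 2 - b ^ 2) - b * cos θ)))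
      / √(a ^ 2 - b ^ 2)) (1 / (a - b * cos θ)) θ := by
  obtain ⟨hb1, hb2⟩ := abs_lt.1 hab
  have ha : 0 < a := (abs_nonneg b).trans_lt hab
  have hS2 : 0 < a ^ 2 - b ^ 2 := by nlinarith
  have hS : 0 < √(a ^ 2 - b ^ 2) := sqrt_pos.2 hS2
  have hSS := sq_sqrt hS2.le
  set S := √(a ^ 2 - b ^ 2)
  have hcos : |b * cos θ| < a := by
    rw [abs_mul]
    nlinarith [abs_nonneg b, abs_cos_le_one θ]
  have hc := (abs_lt.1 hcos).2
  have hD : 0 < a + S - b * cos θ := by linarith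
  have hE : 0 < a - b * cos θ := by linarith
  have hsc := sin_sq_add_cos_sq θ
  have hu : HasDerivAt (fun θ => b * sin θ / (a + S - b * cos θ))
      ((b * cos θ * (a + S - b * cos θ) - b * sin θ * (b * sin θ)) / (a + S - b * cos θ) ^ 2) θ := by
    refine ((hasDerivAt_sin θ).const_mul b).div ?_ hD.ne'
    simpa using ((hasDerivAt_cos θ).const_mul b).const_sub (a + S)
  refine (((hasDerivAt_id θ).add (hu.arctan.const_mul 2)).div_const S).congr_deriv ?_
  have key : (a + S - b * cos θ) ^ 2 + (b * sin θ) ^ 2 = 2 * (a + S) * (a - b * cos θ) := by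
    linear_combination b ^ 2 * hsc + hSS
  have h1 : 1 + (b * sin θ / (a + S - b * cos θ)) ^ 2
      = 2 * (a + S) * (a - b * cos θ) / (a + S - b * cos θ) ^ 2 := by
    rw [← key]; field_simp
  have haS : 0 < a + S := by linarith
  rw [h1]
  field_simp
  linear_combination (-b ^ 2) * hsc - hSS

theorem lintegral_one_div_sub_mul_cos {a b : ℝ} (hab : |b| < a) :
    ∫⁻ θ in Ioc 0 (2 * π), ENNReal.ofReal (1 / (a - b * cos θ))
      = ENNReal.ofReal (2 * π / √(a ^ 2 - b ^ 2)) := by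
  rw [← restrict_Ioo_eq_restrict_Ioc, setLIntegral_Ioo_deriv_of_nonneg two_pi_pos.le
    (fun θ _ => (hasDerivAt_poissonKernel_primitive hab θ).continuousAt.continuousWithinAt)
    (fun θ _ => hasDerivAt_poissonKernel_primitive hab θ)]
  · simp
  · intro θ _
    have : |b * cos θ| < a := by
      rw [abs_mul]
      nlinarith [abs_nonneg b, abs_cos_le_one θ]
    have := (abs_lt.1 this).2
    exact one_div_nonneg.2 (by linarith)

/-- The average over the unit circle of `v ↦ 1 / (a - ⟪x, v⟫)`, which is the Poisson kernel of
the disc up to normalisation. -/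
theorem lintegral_one_div_sub_inner {a : ℝ} {x : Plane} (hx : ‖x‖ < a) :
    ∫⁻ v, ENNReal.ofReal (1 / (a - ⟪x, v⟫)) ∂uniformCircle
      = ENNReal.ofReal (1 / √(a ^ 2 - ‖x‖ ^ 2)) := by
  obtain ⟨α, hα⟩ := exists_norm_smul_dir x
  have hm : Measurable fun v : Plane => ENNReal.ofReal (1 / (a - ⟪x, v⟫)) := by fun_prop
  rw [lintegral_uniformCircle hm α]
  have h1 : ∀ φ, ⟪x, dir φ⟫ = ‖x‖ * cos (φ - α) := by
    intro φ
    conv_lhs => rw [hα, real_inner_smul_left, inner_dir_dir]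
    rw [← cos_neg, neg_sub]
  simp_rw [h1]
  have hpre : (fun φ : ℝ => 1 * φ + -α) ⁻¹' Ioc 0 (2 * π) = Ioc α (α + 2 * π) := by
    ext φ; simp [add_comm]
  have h2 := setLIntegral_comp_mul_add one_pos (-α) (Ioc 0 (2 * π))
    fun θ => ENNReal.ofReal (1 / (a - ‖x‖ * cos θ))
  rw [hpre] at h2
  simp only [one_mul, ← sub_eq_add_neg] at h2
  rw [h2, lintegral_one_div_sub_mul_cos (by rwa [abs_norm]), inv_one, ENNReal.ofReal_one, one_mul,
    ← ENNReal.ofReal_mul (by positivity)]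
  congr 1
  field_simp

/-- The profile `A ↦ A ^ ((m - 1) / 2)` of the flight densities. It vanishes for `A ≤ 0`, by the
conventions for square roots of negative numbers and division by zero. -/
noncomputable def profile (m : ℕ) (A : ℝ) : ℝ := √A ^ m / √A

theorem profile_nonneg (m : ℕ) (A : ℝ) : 0 ≤ profile m A := by unfold profile; positivity

theorem profile_of_nonpos (m : ℕ) {A : ℝ} (hA : A ≤ 0) : profile m A = 0 := by
  simp [profile, sqrt_eq_zero_of_nonpos hA]

@[fun_prop] theorem measurable_profile (m : ℕ) : Measurable (profile m) := by
  unfold profile; fun_prop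

theorem hasDerivAt_sqrt_pow (m : ℕ) {A : ℝ} (hA : 0 < A) :
    HasDerivAt (fun A => 2 / (m + 1) * √A ^ (m + 1)) (profile m A) A := by
  refine (((hasDerivAt_sqrt hA.ne').pow (m + 1)).const_mul (2 / (m + 1 : ℝ))).congr_deriv ?_
  have := sqrt_pos.2 hA
  have : (m + 1 : ℝ) ≠ 0 := by positivity
  rw [profile]
  push_cast [Nat.add_sub_cancel]
  field_simp

/-- The upper limit `L` plays no role: the profile vanishes beyond `A / B ≤ L`. -/
theorem lintegral_profile_sub_mul (m : ℕ) {A B L : ℝ} (hB : 0 < B) (hA : A ≤ B * L) :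
    ∫⁻ s in Ioo 0 L, ENNReal.ofReal (profile m (A - B * s))
      = ENNReal.ofReal (2 / ((m + 1) * B) * √A ^ (m + 1)) := by
  rcases le_or_gt A 0 with h | h
  · have h0 : ∫⁻ s in Ioo 0 L, ENNReal.ofReal (profile m (A - B * s)) = ∫⁻ s in Ioo 0 L, 0 := by
      refine setLIntegral_congr_fun measurableSet_Ioo fun s hs => ?_
      rw [profile_of_nonpos _ (by nlinarith [hs.1]), ENNReal.ofReal_zero]
    simp [h0, sqrt_eq_zero_of_nonpos h]
  · have hAB : A / B ≤ L := by rw [div_le_iff₀ hB]; linarith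
    have h0 : ∫⁻ s in Ioo 0 L, ENNReal.ofReal (profile m (A - B * s))
        = ∫⁻ s in Ioo 0 (A / B), ENNReal.ofReal (profile m (A - B * s)) := by
      rw [← lintegral_indicator measurableSet_Ioo, ← lintegral_indicator measurableSet_Ioo]
      refine lintegral_congr fun s => ?_
      by_cases hs : s ∈ Ioo 0 (A / B)
      · rw [indicator_of_mem hs, indicator_of_mem (Ioo_subset_Ioo_right hAB hs)]
      · rw [indicator_of_notMem hs, indicator_apply_eq_zero]
        intro hs'
        have : A / B ≤ s := by
          by_contra! hlt
          exact hs ⟨hs'.1, hlt⟩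
        rw [div_le_iff₀ hB] at this
        rw [profile_of_nonpos _ (by linarith), ENNReal.ofReal_zero]
    rw [h0, setLIntegral_Ioo_deriv_of_nonneg
      (g := fun s => -(1 / B) * (2 / (m + 1) * √(A - B * s) ^ (m + 1)))
      (div_nonneg h.le hB.le) (by fun_prop) ?_ fun _ _ => profile_nonneg _ _]
    · congr 1
      have : A - B * (A / B) = 0 := by field_simp; ring
      rw [this]
      simp
      field_simp
    · intro s hs
      have hs2 : 0 < A - B * s := by
        have := (lt_div_iff₀ hB).1 hs.2
        linarith
      have h1 : HasDerivAt (fun s => A - B * s) (-B) s := by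
        simpa using ((hasDerivAt_id s).const_mul B).const_sub A
      refine (((hasDerivAt_sqrt_pow m hs2).comp s h1).const_mul (-(1 / B))).congr_deriv ?_
      field_simp

/-- The radial integrals of the flight densities. For `|L| ≤ s` both sides vanish. -/
theorem setLIntegral_profile_radial (m : ℕ) {L s : ℝ} (hs : 0 ≤ s) :
    ∫⁻ y in {y : Plane | s < ‖y‖}, ENNReal.ofReal (profile m (L ^ 2 - ‖y‖ ^ 2))
      = ENNReal.ofReal (2 * π / (m + 1) * √(L ^ 2 - s ^ 2) ^ (m + 1)) := by
  wlog hL : 0 ≤ L generalizing L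
  · simpa using this (L := -L) (by linarith)
  have hS : MeasurableSet {y : Plane | s < ‖y‖} := measurableSet_lt (by fun_prop) (by fun_prop)
  rw [← lintegral_indicator hS,
    lintegral_plane_polar (Measurable.indicator (by fun_prop) hS) 0]
  have hinner : ∀ φ, ∫⁻ ρ in Ioi 0, ENNReal.ofReal ρ * {y : Plane | s < ‖y‖}.indicator
      (fun y => ENNReal.ofReal (profile m (L ^ 2 - ‖y‖ ^ 2))) (ρ • dir φ)
      = ENNReal.ofReal (1 / (m + 1) * √(L ^ 2 - s ^ 2) ^ (m + 1)) := by
    intro φ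
    -- The upper end point `max s L` covers the degenerate case `L ≤ s`, where the interval is empty.
    have h1 : ∫⁻ ρ in Ioi 0, ENNReal.ofReal ρ * {y : Plane | s < ‖y‖}.indicator
        (fun y => ENNReal.ofReal (profile m (L ^ 2 - ‖y‖ ^ 2))) (ρ • dir φ)
        = ∫⁻ ρ in Ioi 0, (Ioo s (max s L)).indicator
          (fun ρ => ENNReal.ofReal (ρ * profile m (L ^ 2 - ρ ^ 2))) ρ := by
      refine setLIntegral_congr_fun measurableSet_Ioi fun ρ (hρ : 0 < ρ) => ?_
      have hn : ‖ρ • dir φ‖ = ρ := by simp [norm_smul, abs_of_pos hρ]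
      by_cases h : s < ρ
      · by_cases h' : ρ < max s L
        · rw [indicator_of_mem (by rwa [mem_ofPred_eq, hn]),
            indicator_of_mem (show ρ ∈ Ioo s (max s L) from ⟨h, h'⟩), hn, ENNReal.ofReal_mul hρ.le]
        · have : L ≤ ρ := (le_max_right s L).trans (not_lt.1 h')
          rw [indicator_of_mem (by rwa [mem_ofPred_eq, hn]), indicator_of_notMem (fun hh => h' hh.2),
            hn, profile_of_nonpos _ (by nlinarith), ENNReal.ofReal_zero, mul_zero]
      · rw [indicator_of_notMem (by rwa [mem_ofPred_eq, hn]), indicator_of_notMem (fun hh => h hh.1),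
          mul_zero]
    rw [h1, setLIntegral_indicator measurableSet_Ioo,
      inter_eq_left.2 (show Ioo s (max s L) ⊆ Ioi 0 from fun ρ hρ => hs.trans_lt hρ.1),
      setLIntegral_Ioo_deriv_of_nonneg
      (g := fun ρ => -(1 / 2) * (2 / (m + 1) * √(L ^ 2 - ρ ^ 2) ^ (m + 1)))
      (le_max_left _ _) (by fun_prop) ?_
      fun ρ hρ => mul_nonneg (hs.trans hρ.1.le) (profile_nonneg _ _)]
    · congr 1
      have : √(L ^ 2 - max s L ^ 2) = 0 :=
        sqrt_eq_zero_of_nonpos (by nlinarith [le_max_right s L])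
      rw [this]
      simp
      field_simp
    · intro ρ hρ
      have hρ0 : 0 < ρ := hs.trans_lt hρ.1
      have hρL : ρ < L := (lt_max_iff.1 hρ.2).resolve_left hρ.1.le.not_gt
      have hρ2 : 0 < L ^ 2 - ρ ^ 2 := by nlinarith
      have h1 : HasDerivAt (fun ρ => L ^ 2 - ρ ^ 2) (-(2 * ρ)) ρ := by
        simpa using (hasDerivAt_pow 2 ρ).const_sub (L ^ 2)
      refine (((hasDerivAt_sqrt_pow m hρ2).comp ρ h1).const_mul (-(1 / 2))).congr_deriv ?_
      ring
  simp_rw [hinner]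
  rw [setLIntegral_const, Real.volume_Ioc, ← ENNReal.ofReal_mul (by positivity)]
  congr 1
  ring

/-! ### One more displacement -/

/-- Adding one more uniformly directed displacement raises the exponent of the profile by one half.
After Tonelli the integral over the length of the displacement is elementary, because the argument of
the profile is affine in that length, and it leaves a Poisson kernel to be averaged over the
direction. -/
theorem lintegral_profile_step (m : ℕ) {L : ℝ} (hL : 0 ≤ L) {f : Plane → ℝ≥0∞}
    (hf : Measurable f) :
    ∫⁻ a in Ioo 0 L, ∫⁻ v, (∫⁻ x, f (a • v + x) *
        ENNReal.ofReal (profile m ((L - a) ^ 2 - ‖x‖ ^ 2))) ∂uniformCircle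
      = ENNReal.ofReal (1 / (m + 1)) *
        ∫⁻ x, f x * ENNReal.ofReal (profile (m + 1) (L ^ 2 - ‖x‖ ^ 2)) := by
  have hH : Measurable fun p : ℝ × Plane × Plane =>
      f p.2.2 * ENNReal.ofReal (profile m ((L - p.1) ^ 2 - ‖p.2.2 - p.1 • p.2.1‖ ^ 2)) := by
    fun_prop
  calc
    _ = ∫⁻ a in Ioo 0 L, ∫⁻ v, (∫⁻ x, f x *
        ENNReal.ofReal (profile m ((L - a) ^ 2 - ‖x - a • v‖ ^ 2))) ∂uniformCircle := by
      refine lintegral_congr fun a => lintegral_congr fun v => ?_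
      rw [← lintegral_add_left_eq_self (fun x => f x *
        ENNReal.ofReal (profile m ((L - a) ^ 2 - ‖x - a • v‖ ^ 2))) (a • v)]
      simp
    _ = ∫⁻ x, ∫⁻ v, (∫⁻ a in Ioo 0 L, f x *
        ENNReal.ofReal (profile m ((L - a) ^ 2 - ‖x - a • v‖ ^ 2))) ∂uniformCircle := by
      have h1 : ∀ a : ℝ, ∫⁻ v, (∫⁻ x, f x *
          ENNReal.ofReal (profile m ((L - a) ^ 2 - ‖x - a • v‖ ^ 2))) ∂uniformCircle
          = ∫⁻ x, ∫⁻ v, f x *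
          ENNReal.ofReal (profile m ((L - a) ^ 2 - ‖x - a • v‖ ^ 2)) ∂uniformCircle := fun a =>
        lintegral_lintegral_swap (hH.comp (measurable_const.prodMk measurable_id)).aemeasurable
      simp_rw [h1]
      rw [lintegral_lintegral_swap]
      · refine lintegral_congr fun x => lintegral_lintegral_swap ?_
        exact (hH.comp (measurable_fst.prodMk
          (measurable_snd.prodMk measurable_const))).aemeasurable
      · refine Measurable.aemeasurable ?_
        exact Measurable.lintegral_prod_right' (f := fun p : (ℝ × Plane) × Plane => f p.1.2 *
          ENNReal.ofReal (profile m ((L - p.1.1) ^ 2 - ‖p.1.2 - p.1.1 • p.2‖ ^ 2))) (by fun_prop)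
    _ = ∫⁻ x, ENNReal.ofReal (1 / (m + 1)) *
        (f x * ENNReal.ofReal (profile (m + 1) (L ^ 2 - ‖x‖ ^ 2))) := by
      refine lintegral_congr fun x => ?_
      have hpull : ∀ v, ∫⁻ a in Ioo 0 L, f x *
          ENNReal.ofReal (profile m ((L - a) ^ 2 - ‖x - a • v‖ ^ 2))
          = f x * ∫⁻ a in Ioo 0 L,
            ENNReal.ofReal (profile m ((L - a) ^ 2 - ‖x - a • v‖ ^ 2)) := fun v =>
        lintegral_const_mul _ (by fun_prop)
      simp_rw [hpull]
      have hmeas : Measurable fun v : Plane => ∫⁻ a in Ioo 0 L,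
          ENNReal.ofReal (profile m ((L - a) ^ 2 - ‖x - a • v‖ ^ 2)) :=
        Measurable.lintegral_prod_right' (f := fun p : Plane × ℝ =>
          ENNReal.ofReal (profile m ((L - p.2) ^ 2 - ‖x - p.2 • p.1‖ ^ 2))) (by fun_prop)
      rw [lintegral_const_mul _ hmeas, mul_left_comm]
      congr 1
      rcases lt_or_ge ‖x‖ L with hx | hx
      · have hA : 0 < L ^ 2 - ‖x‖ ^ 2 := by nlinarith [norm_nonneg x]
        have hS := sqrt_pos.2 hA
        calc
          _ = ∫⁻ v, ENNReal.ofReal (1 / (m + 1) * √(L ^ 2 - ‖x‖ ^ 2) ^ (m + 1)) *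
              ENNReal.ofReal (1 / (L - ⟪x, v⟫)) ∂uniformCircle := by
            refine lintegral_congr_ae ?_
            filter_upwards [ae_norm_eq_one_uniformCircle] with v hv
            have hxv : ⟪x, v⟫ < L := by
              have := real_inner_le_norm x v
              rw [hv, mul_one] at this
              exact this.trans_lt hx
            have harg : ∀ a, (L - a) ^ 2 - ‖x - a • v‖ ^ 2
                = L ^ 2 - ‖x‖ ^ 2 - 2 * (L - ⟪x, v⟫) * a := by
              intro a
              rw [norm_sub_sq_real, norm_smul, real_inner_smul_right, hv, mul_one, norm_eq_abs,
                sq_abs]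
              ring
            simp_rw [harg]
            rw [lintegral_profile_sub_mul m (by linarith),
              ← ENNReal.ofReal_mul (by positivity)]
            · congr 1
              have : L - ⟪x, v⟫ ≠ 0 := by linarith
              field_simp
            -- This is `0 ≤ ‖x - L • v‖ ^ 2`.
            · have := harg L
              nlinarith [sq_nonneg ‖x - L • v‖]
          _ = _ := by
            rw [lintegral_const_mul _ (by fun_prop), lintegral_one_div_sub_inner hx,
              ← ENNReal.ofReal_mul (by positivity), ← ENNReal.ofReal_mul (by positivity), profile]
            congr 1
            ring
      · rw [profile_of_nonpos, ENNReal.ofReal_zero, mul_zero]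
        · calc
            _ = ∫⁻ v, 0 ∂uniformCircle := by
              refine lintegral_congr_ae ?_
              filter_upwards [ae_norm_eq_one_uniformCircle] with v hv
              rw [setLIntegral_congr_fun (g := fun _ => 0) measurableSet_Ioo]
              · simp
              · intro a ha
                have h1 : ‖x‖ - ‖a • v‖ ≤ ‖x - a • v‖ := norm_sub_norm_le _ _
                rw [norm_smul, hv, mul_one, norm_eq_abs, abs_of_pos ha.1] at h1
                dsimp only
                rw [profile_of_nonpos, ENNReal.ofReal_zero]
                nlinarith [ha.2]
            _ = 0 := by simp
        · nlinarith
    _ = _ := lintegral_const_mul _ (by fun_prop)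

/-! ### Two displacements -/

/-- The reflection of `dir α` in the line orthogonal to `dir ψ`: its angle runs at twice the speed
of `ψ`. -/
theorem dir_add_smul_dir (α ψ : ℝ) :
    dir α + (-2 * cos (ψ - α)) • dir ψ = dir (2 * ψ + (π - α)) := by
  have h : 2 * ψ + (π - α) = ψ + (ψ - α) + π := by ring
  have h' : α = ψ - (ψ - α) := by ring
  rw [h]
  generalize ψ - α = β at *
  subst h'
  ext i
  fin_cases i
  · simp [sin_add, sin_sub]; ring
  · simp [cos_add, cos_sub]; ring

/-- The law of `a • v + (L - a) • w` for fixed `w = dir α`, uniform direction `v` and uniform `a ∈ (0, L)`.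
In polar coordinates centred at `L • w` the point at angle `ψ` is
`L • w + a • (v - w)` with `v` the reflection of `w` in the line orthogonal to `dir ψ`. -/
theorem lintegral_two_steps_fixed {L : ℝ} (α : ℝ) {f : Plane → ℝ≥0∞} (hf : Measurable f) :
    ∫⁻ y in Metric.ball 0 L, f y * ENNReal.ofReal (1 / (L - ⟪y, dir α⟫))
      = ENNReal.ofReal (2 * π) *
        ∫⁻ v, (∫⁻ a in Ioo 0 L, f (a • v + (L - a) • dir α)) ∂uniformCircle := by
  set w := dir α with hw
  have hFm : Measurable ((Metric.ball 0 L).indicator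
      fun y => f y * ENNReal.ofReal (1 / (L - ⟪y, w⟫))) :=
    Measurable.indicator (by fun_prop) Metric.isOpen_ball.measurableSet
  have hFm' : Measurable fun x => (Metric.ball 0 L).indicator
      (fun y => f y * ENNReal.ofReal (1 / (L - ⟪y, w⟫))) (L • w + x) :=
    hFm.comp (measurable_const_add _)
  have hHm : Measurable fun v => ∫⁻ a in Ioo 0 L, f (a • v + (L - a) • w) :=
    Measurable.lintegral_prod_right'
      (f := fun p : Plane × ℝ => f (p.2 • p.1 + (L - p.2) • w)) (by fun_prop)
  rw [← lintegral_indicator Metric.isOpen_ball.measurableSet,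
    ← lintegral_add_left_eq_self _ (L • w),
    lintegral_plane_polar hFm' (α - π / 2)]
  have hnorm : ∀ ρ ψ, ‖L • w + ρ • dir ψ‖ ^ 2 = L ^ 2 + 2 * L * ρ * cos (ψ - α) + ρ ^ 2 := by
    intro ρ ψ
    rw [norm_add_sq_real, norm_smul, norm_smul, real_inner_smul_left, real_inner_smul_right,
      real_inner_comm, inner_dir_dir]
    simp [hw]
    ring
  -- The rays from `L • w` at these angles do not meet the open disc.
  have hzero : ∀ ψ, 0 ≤ cos (ψ - α) → ∫⁻ ρ in Ioi 0, ENNReal.ofReal ρ *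
      ((Metric.ball 0 L).indicator (fun y => f y * ENNReal.ofReal (1 / (L - ⟪y, w⟫))))
        (L • w + ρ • dir ψ) = 0 := by
    intro ψ hψ
    rw [setLIntegral_congr_fun (g := fun _ => 0) measurableSet_Ioi]
    · simp
    · intro ρ (hρ : 0 < ρ)
      dsimp only
      rw [indicator_of_notMem, mul_zero]
      rw [mem_ball_zero_iff, not_lt]
      rcases le_or_gt L 0 with hL | hL
      · exact hL.trans (norm_nonneg _)
      · refine le_of_sq_le_sq ?_ (norm_nonneg _)
        rw [hnorm]
        have : 0 ≤ 2 * L * ρ * cos (ψ - α) := by positivity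
        nlinarith
  -- The other rays meet the disc in a chord of length `-2 * cos (ψ - α) * L`, which is traversed
  -- by `ρ = -2 * cos (ψ - α) * a`; the Jacobian `ρ` cancels the singularity of the density.
  have hpos : ∀ ψ, cos (ψ - α) < 0 → ∫⁻ ρ in Ioi 0, ENNReal.ofReal ρ *
      ((Metric.ball 0 L).indicator (fun y => f y * ENNReal.ofReal (1 / (L - ⟪y, w⟫))))
        (L • w + ρ • dir ψ)
      = 2 * ∫⁻ a in Ioo 0 L, f (a • dir (2 * ψ + (π - α)) + (L - a) • w) := by
    intro ψ hψ
    have hk : 0 < -2 * cos (ψ - α) := by linarith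
    calc
      _ = ∫⁻ ρ in Ioi 0, (Ioo 0 (-2 * cos (ψ - α) * L)).indicator (fun ρ =>
            ENNReal.ofReal (2 / (-2 * cos (ψ - α))) * f (L • w + ρ • dir ψ)) ρ := by
        refine setLIntegral_congr_fun measurableSet_Ioi fun ρ (hρ : 0 < ρ) => ?_
        by_cases hρL : ρ < -2 * cos (ψ - α) * L
        · have hL : 0 < L := by
            by_contra! h
            nlinarith
          rw [indicator_of_mem, indicator_of_mem (show ρ ∈ Ioo 0 _ from ⟨hρ, hρL⟩), mul_left_comm,
            mul_comm (ENNReal.ofReal _) (f _), ← ENNReal.ofReal_mul hρ.le]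
          · congr 2
            rw [inner_add_left, real_inner_smul_left, real_inner_smul_left, inner_dir_dir, hw,
              inner_dir_dir, sub_self, cos_zero]
            have : cos (ψ - α) ≠ 0 := hψ.ne
            have h2 : L - (L * 1 + ρ * cos (ψ - α)) = -(ρ * cos (ψ - α)) := by ring
            rw [h2]
            field_simp
          · rw [mem_ball_zero_iff]
            refine lt_of_pow_lt_pow_left₀ 2 hL.le ?_
            rw [hnorm]
            nlinarith
        · rw [indicator_of_notMem, indicator_of_notMem (fun h => hρL h.2), mul_zero]
          rw [mem_ball_zero_iff, not_lt]
          rcases le_or_gt L 0 with hL | hL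
          · exact hL.trans (norm_nonneg _)
          · refine le_of_sq_le_sq ?_ (norm_nonneg _)
            rw [hnorm]
            nlinarith
      _ = ENNReal.ofReal (2 / (-2 * cos (ψ - α))) *
            ∫⁻ ρ in Ioo 0 (-2 * cos (ψ - α) * L), f (L • w + ρ • dir ψ) := by
        rw [setLIntegral_indicator measurableSet_Ioo,
          inter_eq_left.2 (Ioo_subset_Ioi_self), lintegral_const_mul _ (by fun_prop)]
      _ = 2 * ∫⁻ a in Ioo 0 L, f (L • w + (-2 * cos (ψ - α) * a) • dir ψ) := by
        have h := setLIntegral_comp_mul_add hk 0 (Ioo 0 (-2 * cos (ψ - α) * L))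
          fun ρ => f (L • w + ρ • dir ψ)
        have hpre : (fun x : ℝ => -2 * cos (ψ - α) * x + 0) ⁻¹' Ioo 0 (-2 * cos (ψ - α) * L)
            = Ioo 0 L := by
          ext x
          simp only [add_zero, mem_preimage, mem_Ioo, mul_lt_mul_iff_right₀ hk,
            mul_pos_iff_of_pos_left hk]
        rw [hpre] at h
        simp only [add_zero] at h
        rw [h, ← mul_assoc, div_eq_mul_inv, ENNReal.ofReal_mul zero_le_two, ENNReal.ofReal_ofNat]
      _ = _ := by
        congr 1
        refine lintegral_congr fun a => ?_
        rw [← dir_add_smul_dir]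
        congr 1
        module
  have hsplit : Ioc (α - π / 2) (α - π / 2 + 2 * π)
      = Ioc (α - π / 2) (α + π / 2) ∪ Ioc (α + π / 2) (α + π / 2 + π) := by
    rw [Ioc_union_Ioc_eq_Ioc (by linarith [pi_pos]) (by linarith [pi_pos])]
    congr 1; ring
  rw [hsplit, lintegral_union measurableSet_Ioc (Ioc_disjoint_Ioc_of_le le_rfl)]
  have hfirst : ∫⁻ ψ in Ioc (α - π / 2) (α + π / 2), (∫⁻ ρ in Ioi 0, ENNReal.ofReal ρ *
      ((Metric.ball 0 L).indicator (fun y => f y * ENNReal.ofReal (1 / (L - ⟪y, w⟫))))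
        (L • w + ρ • dir ψ)) = 0 := by
    rw [setLIntegral_congr_fun (g := fun _ => 0) measurableSet_Ioc]
    · simp
    · intro ψ hψ
      exact hzero ψ (cos_nonneg_of_mem_Icc ⟨by linarith [hψ.1], by linarith [hψ.2]⟩)
  have hsecond : ∫⁻ ψ in Ioc (α + π / 2) (α + π / 2 + π), (∫⁻ ρ in Ioi 0, ENNReal.ofReal ρ *
      ((Metric.ball 0 L).indicator (fun y => f y * ENNReal.ofReal (1 / (L - ⟪y, w⟫))))
        (L • w + ρ • dir ψ))
      = ∫⁻ ψ in Ioc (α + π / 2) (α + π / 2 + π),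
        2 * ∫⁻ a in Ioo 0 L, f (a • dir (2 * ψ + (π - α)) + (L - a) • w) := by
    rw [setLIntegral_congr Ioo_ae_eq_Ioc.symm,
      setLIntegral_congr (s := Ioc (α + π / 2) (α + π / 2 + π)) Ioo_ae_eq_Ioc.symm]
    refine setLIntegral_congr_fun measurableSet_Ioo fun ψ hψ => hpos ψ ?_
    exact cos_neg_of_pi_div_two_lt_of_lt (by linarith [hψ.1]) (by linarith [hψ.2])
  rw [hfirst, hsecond, zero_add, lintegral_const_mul _ (by fun_prop)]
  -- The substitution `φ = 2 * ψ + (π - α)` turns the half period of `ψ` into a full period of `φ`.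
  have h := setLIntegral_comp_mul_add two_pos (π - α) (Ioc (α + 2 * π) (α + 2 * π + 2 * π))
    fun φ => ∫⁻ a in Ioo 0 L, f (a • dir φ + (L - a) • w)
  have hpre : (fun x : ℝ => 2 * x + (π - α)) ⁻¹' Ioc (α + 2 * π) (α + 2 * π + 2 * π)
      = Ioc (α + π / 2) (α + π / 2 + π) := by
    ext x
    simp only [mem_preimage, mem_Ioc]
    constructor <;> rintro ⟨h1, h2⟩ <;> constructor <;> linarith
  rw [hpre] at h
  rw [h, lintegral_uniformCircle hHm (α + 2 * π), ← mul_assoc, ← mul_assoc,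
    ← ENNReal.ofReal_mul (by positivity), mul_inv_cancel₀ (by positivity), ENNReal.ofReal_one]
  rw [ENNReal.ofReal_inv_of_pos two_pos, ENNReal.ofReal_ofNat,
    ENNReal.mul_inv_cancel two_ne_zero ENNReal.ofNat_ne_top]

/-- The law of a flight with exactly one change of direction, at a uniform instant. -/
theorem lintegral_two_steps {L : ℝ} (hL : 0 ≤ L) {f : Plane → ℝ≥0∞} (hf : Measurable f) :
    ∫⁻ a in Ioo 0 L, ∫⁻ v, (∫⁻ w, f (a • v + (L - a) • w) ∂uniformCircle) ∂uniformCircle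
      = ENNReal.ofReal (2 * π)⁻¹ *
        ∫⁻ x, f x * ENNReal.ofReal (profile 0 (L ^ 2 - ‖x‖ ^ 2)) := by
  have hball : MeasurableSet (Metric.ball (0 : Plane) L) := Metric.isOpen_ball.measurableSet
  calc
    _ = ∫⁻ w, (∫⁻ v, (∫⁻ a in Ioo 0 L, f (a • v + (L - a) • w)) ∂uniformCircle)
        ∂uniformCircle := by
      have h1 : ∀ a : ℝ, ∫⁻ v, (∫⁻ w, f (a • v + (L - a) • w) ∂uniformCircle) ∂uniformCircle
          = ∫⁻ w, (∫⁻ v, f (a • v + (L - a) • w) ∂uniformCircle) ∂uniformCircle := fun a =>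
        lintegral_lintegral_swap (by fun_prop)
      simp_rw [h1]
      rw [lintegral_lintegral_swap]
      · refine lintegral_congr fun w => lintegral_lintegral_swap ?_
        fun_prop
      · refine Measurable.aemeasurable ?_
        exact Measurable.lintegral_prod_right' (f := fun p : (ℝ × Plane) × Plane =>
          f (p.1.1 • p.2 + (L - p.1.1) • p.1.2)) (by fun_prop)
    _ = ∫⁻ w, ENNReal.ofReal (2 * π)⁻¹ * (∫⁻ y in Metric.ball 0 L,
        f y * ENNReal.ofReal (1 / (L - ⟪y, w⟫))) ∂uniformCircle := by
      refine lintegral_congr_ae ?_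
      filter_upwards [ae_norm_eq_one_uniformCircle] with w hw
      obtain ⟨α, hα⟩ := exists_norm_smul_dir w
      rw [hw, one_smul] at hα
      subst hα
      rw [lintegral_two_steps_fixed α hf, ← mul_assoc, ← ENNReal.ofReal_mul (by positivity),
        inv_mul_cancel₀ (by positivity), ENNReal.ofReal_one, one_mul]
    _ = ENNReal.ofReal (2 * π)⁻¹ * ∫⁻ y in Metric.ball 0 L, (∫⁻ w,
        f y * ENNReal.ofReal (1 / (L - ⟪y, w⟫)) ∂uniformCircle) := by
      rw [lintegral_const_mul, lintegral_lintegral_swap]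
      · exact Measurable.aemeasurable (f := fun p : Plane × Plane =>
          f p.2 * ENNReal.ofReal (1 / (L - ⟪p.2, p.1⟫))) (by fun_prop)
      · exact Measurable.lintegral_prod_right' (f := fun p : Plane × Plane =>
          f p.2 * ENNReal.ofReal (1 / (L - ⟪p.2, p.1⟫))) (by fun_prop)
    _ = _ := by
      congr 1
      rw [← lintegral_indicator hball]
      refine lintegral_congr fun y => ?_
      by_cases hy : y ∈ Metric.ball 0 L
      · rw [indicator_of_mem hy, lintegral_const_mul _ (by fun_prop),
          lintegral_one_div_sub_inner (mem_ball_zero_iff.1 hy), profile, pow_zero]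
      · rw [indicator_of_notMem hy, profile_of_nonpos, ENNReal.ofReal_zero, mul_zero]
        rw [mem_ball_zero_iff, not_lt] at hy
        nlinarith

/-! ### Independent sequences and waiting times -/

/-- The sequence with first term `x` and remaining terms `u`. -/
def consSeq {α : Type*} (x : α) (u : ℕ → α) : ℕ → α
  | 0 => x
  | n + 1 => u n

@[simp] theorem consSeq_zero {α : Type*} (x : α) (u : ℕ → α) : consSeq x u 0 = x := rfl
@[simp] theorem consSeq_succ {α : Type*} (x : α) (u : ℕ → α) (n : ℕ) :
    consSeq x u (n + 1) = u n := rfl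

theorem measurable_consSeq {α : Type*} [MeasurableSpace α] :
    Measurable fun p : α × (ℕ → α) => consSeq p.1 p.2 := by
  refine measurable_pi_iff.2 fun n => ?_
  cases n with
  | zero => exact measurable_fst
  | succ n => exact (measurable_pi_apply n).comp measurable_snd

/-- The law of a sequence of independent variables with common law `μ`. -/
noncomputable abbrev iidLaw {α : Type*} [MeasurableSpace α] (μ : Measure α) : Measure (ℕ → α) :=
  Measure.infinitePi fun _ => μ

theorem map_consSeq_iidLaw {α : Type*} [MeasurableSpace α] (μ : Measure α)
    [IsProbabilityMeasure μ] :
    (μ.prod (iidLaw μ)).map (fun p => consSeq p.1 p.2) = iidLaw μ := by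
  refine Measure.eq_infinitePi _ fun s t ht => ?_
  classical
  -- Boxes over `s` are rewritten as boxes over an initial segment, which split off the first term.
  have hs : s ⊆ Finset.range (s.sup id + 1) := fun i hi =>
    Finset.mem_range.2 (Nat.lt_succ_of_le (Finset.le_sup (f := id) hi))
  set N := s.sup id
  set t' : ℕ → Set α := fun i => if i ∈ s then t i else univ with ht'
  have hmt : ∀ i, MeasurableSet (t' i) := fun i => by
    rw [ht']; dsimp only; split_ifs
    exacts [ht i, .univ]
  have hpi : Set.pi (s : Set ℕ) t = Set.pi (Finset.range (N + 1) : Set ℕ) t' := by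
    ext u
    simp only [Set.mem_pi, Finset.mem_coe, ht']
    refine ⟨fun h i _ => ?_, fun h i hi => by simpa [hi] using h i (hs hi)⟩
    split_ifs with hi
    exacts [h i hi, mem_univ _]
  have hpre : (fun p : α × (ℕ → α) => consSeq p.1 p.2) ⁻¹' Set.pi (Finset.range (N + 1) : Set ℕ) t'
      = t' 0 ×ˢ Set.pi (Finset.range N : Set ℕ) (fun i => t' (i + 1)) := by
    ext ⟨x, u⟩
    simp only [mem_preimage, Set.mem_pi, Finset.mem_coe, Finset.mem_range, mem_prod]
    constructor
    · exact fun h => ⟨h 0 (Nat.succ_pos _), fun i hi => h (i + 1) (Nat.succ_lt_succ hi)⟩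
    · rintro ⟨h0, h⟩ (_ | i) hi
      exacts [h0, h i (Nat.lt_of_succ_lt_succ hi)]
  rw [hpi, Measure.map_apply measurable_consSeq (.pi (Finset.countable_toSet _) fun i _ => hmt i),
    hpre, Measure.prod_prod, Measure.infinitePi_pi _ fun i _ => hmt _, mul_comm,
    ← Finset.prod_range_succ' (fun i => μ (t' i)), ← Finset.prod_subset hs]
  · exact Finset.prod_congr rfl fun i hi => by simp [ht', hi]
  · exact fun i _ hi => by simp [ht', hi]

theorem lintegral_iidLaw {α : Type*} [MeasurableSpace α] (μ : Measure α) [IsProbabilityMeasure μ]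
    {F : (ℕ → α) → ℝ≥0∞} (hF : Measurable F) :
    ∫⁻ u, F u ∂iidLaw μ = ∫⁻ x, (∫⁻ u, F (consSeq x u) ∂iidLaw μ) ∂μ := by
  conv_lhs => rw [← map_consSeq_iidLaw μ]
  rw [lintegral_map hF measurable_consSeq,
    lintegral_prod (fun p : α × (ℕ → α) => F (consSeq p.1 p.2))
      (hF.comp measurable_consSeq).aemeasurable]

/-- The instant of the `n`-th change of direction when the successive waiting times are `τ`. -/
def jumpTime (τ : ℕ → ℝ) (n : ℕ) : ℝ := ∑ k ∈ Finset.range n, τ k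

/-- The sequences of positive waiting times with exactly `n` changes of direction up to time `t`.
Positivity, which holds almost surely, is part of the definition, so that these sets are disjoint for
different `n` and satisfy an exact recursion (`consSeq_mem_exactJumps_succ`). -/
def exactJumps (n : ℕ) (t : ℝ) : Set (ℕ → ℝ) :=
  {τ | (∀ k, 0 < τ k) ∧ jumpTime τ n ≤ t ∧ t < jumpTime τ (n + 1)}

/-- The position at time `t` of the free flight with directions `v` and waiting times `τ`, provided that
exactly `n` changes of direction have happened. -/
noncomputable def position (c : ℝ) (n : ℕ) (t : ℝ) (v : ℕ → Plane) (τ : ℕ → ℝ) : Plane :=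
  c • (∑ k ∈ Finset.range n, τ k • v k + (t - jumpTime τ n) • v n)

theorem measurable_jumpTime (n : ℕ) : Measurable fun τ : ℕ → ℝ => jumpTime τ n := by
  unfold jumpTime; fun_prop

theorem measurableSet_exactJumps (n : ℕ) (t : ℝ) : MeasurableSet (exactJumps n t) := by
  refine .inter ?_ (.inter (measurableSet_le (measurable_jumpTime n) measurable_const)
    (measurableSet_lt measurable_const (measurable_jumpTime (n + 1))))
  change MeasurableSet {τ : ℕ → ℝ | ∀ k, 0 < τ k}
  rw [ofPred_forall]
  exact .iInter fun k => measurableSet_lt measurable_const (by fun_prop)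

theorem jumpTime_consSeq (s : ℝ) (τ : ℕ → ℝ) (n : ℕ) :
    jumpTime (consSeq s τ) (n + 1) = s + jumpTime τ n := by
  simp [jumpTime, Finset.sum_range_succ', add_comm]

theorem consSeq_mem_exactJumps_succ {s t : ℝ} {τ : ℕ → ℝ} {n : ℕ} :
    consSeq s τ ∈ exactJumps (n + 1) t ↔ 0 < s ∧ τ ∈ exactJumps n (t - s) := by
  simp only [exactJumps, mem_ofPred_eq, jumpTime_consSeq, le_sub_iff_add_le', sub_lt_iff_lt_add',
    ← and_assoc]
  refine and_congr_left fun _ => and_congr_left fun _ => ?_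
  exact ⟨fun h => ⟨h 0, fun k => h (k + 1)⟩, fun h k => by cases k with
    | zero => exact h.1
    | succ k => exact h.2 k⟩

theorem nonneg_of_mem_exactJumps {t : ℝ} {τ : ℕ → ℝ} {n : ℕ} (h : τ ∈ exactJumps n t) : 0 ≤ t :=
  (Finset.sum_nonneg fun k _ => (h.1 k).le).trans h.2.1

theorem position_consSeq (c : ℝ) (n : ℕ) (t : ℝ) (x : Plane) (v : ℕ → Plane) (s : ℝ)
    (τ : ℕ → ℝ) :
    position c (n + 1) t (consSeq x v) (consSeq s τ)
      = (c * s) • x + position c n (t - s) v τ := by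
  simp only [position, jumpTime_consSeq, Finset.sum_range_succ', consSeq_zero, consSeq_succ]
  module

theorem lintegral_expMeasure (lam : ℝ) {f : ℝ → ℝ≥0∞} (hf : Measurable f) :
    ∫⁻ s, f s ∂expMeasure lam
      = ∫⁻ s in Ioi 0, ENNReal.ofReal (lam * exp (-(lam * s))) * f s := by
  have hd : expMeasure lam = volume.withDensity (exponentialPDF lam) := rfl
  have hm : Measurable (exponentialPDF lam) := (measurable_exponentialPDFReal lam).ennreal_ofReal
  rw [hd, lintegral_withDensity_eq_lintegral_mul _ hm hf,
    setLIntegral_congr Ioi_ae_eq_Ici, ← lintegral_indicator measurableSet_Ici]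
  refine lintegral_congr fun s => ?_
  by_cases hs : 0 ≤ s
  · rw [indicator_of_mem (mem_Ici.2 hs), Pi.mul_apply, exponentialPDF_of_nonneg hs]
  · rw [indicator_of_notMem (by simpa using hs), Pi.mul_apply,
      exponentialPDF_of_neg (not_le.1 hs), zero_mul]

theorem expMeasure_Ioi {lam : ℝ} (hlam : 0 < lam) {t : ℝ} (ht : 0 ≤ t) :
    expMeasure lam (Ioi t) = ENNReal.ofReal (exp (-lam * t)) := by
  have := isProbabilityMeasure_expMeasure hlam
  have h := prob_compl_eq_one_sub (μ := expMeasure lam) (measurableSet_Iic (a := t))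
  rw [compl_Iic, ← ofReal_cdf, cdf_expMeasure_eq hlam, if_pos ht] at h
  rw [h, ← ENNReal.ofReal_one, ← ENNReal.ofReal_sub _ (by simp; positivity)]
  congr 1
  ring_nf

/-! ### The renewal equation -/

/-- The expectation of `f` at the position at time `t`, restricted to the event of exactly `n`
changes of direction. -/
noncomputable def flightExpectation (lam c : ℝ) (n : ℕ) (t : ℝ) (f : Plane → ℝ≥0∞) : ℝ≥0∞ :=
  ∫⁻ τ, (∫⁻ v, (exactJumps n t).indicator (fun τ => f (position c n t v τ)) τ
    ∂iidLaw uniformCircle) ∂iidLaw (expMeasure lam)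

theorem measurable_indicator_position (c : ℝ) (n : ℕ) (t : ℝ) {f : Plane → ℝ≥0∞}
    (hf : Measurable f) :
    Measurable fun p : (ℕ → ℝ) × (ℕ → Plane) =>
      (exactJumps n t).indicator (fun τ => f (position c n t p.2 τ)) p.1 := by
  have h1 : Measurable fun p : (ℕ → ℝ) × (ℕ → Plane) => f (position c n t p.2 p.1) := by
    unfold position jumpTime
    fun_prop
  exact h1.indicator (measurable_fst (measurableSet_exactJumps n t))

theorem flightExpectation_zero {lam : ℝ} (hlam : 0 < lam) (c : ℝ) {t : ℝ} (ht : 0 ≤ t)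
    {f : Plane → ℝ≥0∞} (hf : Measurable f) :
    flightExpectation lam c 0 t f
      = ENNReal.ofReal (exp (-lam * t)) * ∫⁻ v, f ((c * t) • v) ∂uniformCircle := by
  have := isProbabilityMeasure_expMeasure hlam
  have hev : ∀ k, MeasurePreserving (fun τ : ℕ → ℝ => τ k) (iidLaw (expMeasure lam))
      (expMeasure lam) := measurePreserving_eval_infinitePi _
  have hpos : ∀ᵐ τ ∂iidLaw (expMeasure lam), ∀ k, 0 < τ k := by
    refine ae_all_iff.2 fun k => (hev k).quasiMeasurePreserving.ae (p := fun s => 0 < s) ?_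
    refine (prob_compl_eq_zero_iff measurableSet_Ioi).2 ?_
    rw [expMeasure_Ioi hlam le_rfl, mul_zero, exp_zero, ENNReal.ofReal_one]
  have hmS : MeasurableSet {τ : ℕ → ℝ | t < τ 0} :=
    measurableSet_lt measurable_const (measurable_pi_apply 0)
  calc
    _ = ∫⁻ τ, {τ : ℕ → ℝ | t < τ 0}.indicator
        (fun _ => ∫⁻ v, f ((c * t) • v) ∂uniformCircle) τ ∂iidLaw (expMeasure lam) := by
      refine lintegral_congr_ae ?_
      filter_upwards [hpos] with τ hτ
      by_cases h : t < τ 0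
      · rw [indicator_of_mem (show τ ∈ {τ : ℕ → ℝ | t < τ 0} from h)]
        have hmem : τ ∈ exactJumps 0 t := ⟨hτ, by simpa [jumpTime], by simpa [jumpTime]⟩
        simp_rw [indicator_of_mem hmem]
        rw [← (measurePreserving_eval_infinitePi (fun _ : ℕ => uniformCircle) 0).lintegral_comp
          (f := fun v => f ((c * t) • v)) (by fun_prop)]
        simp [position, jumpTime, smul_smul]
      · rw [indicator_of_notMem (show τ ∉ {τ : ℕ → ℝ | t < τ 0} from h)]
        have hmem : τ ∉ exactJumps 0 t := fun hm => h (by simpa [jumpTime] using hm.2.2)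
        simp [indicator_of_notMem hmem]
    _ = _ := by
      rw [lintegral_indicator_const hmS, mul_comm, ← expMeasure_Ioi hlam ht,
        ← (hev 0).measure_preimage measurableSet_Ioi.nullMeasurableSet]
      rfl

/-- The renewal equation: conditioning on the first waiting time and the first direction. -/
theorem flightExpectation_succ {lam : ℝ} (hlam : 0 < lam) (c : ℝ) (n : ℕ) (t : ℝ)
    {f : Plane → ℝ≥0∞} (hf : Measurable f) :
    flightExpectation lam c (n + 1) t f
      = ∫⁻ s in Ioo 0 t, ENNReal.ofReal (lam * exp (-(lam * s))) *
        ∫⁻ x, flightExpectation lam c n (t - s) (fun y => f ((c * s) • x + y)) ∂uniformCircle := by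
  have := isProbabilityMeasure_expMeasure hlam
  have hmG := measurable_indicator_position c (n + 1) t hf
  have hmF : Measurable fun p : (((ℝ × Plane) × (ℕ → ℝ)) × (ℕ → Plane)) =>
      (exactJumps (n + 1) t).indicator
        (fun τ => f (position c (n + 1) t (consSeq p.1.1.2 p.2) τ)) (consSeq p.1.1.1 p.1.2) :=
    hmG.comp ((measurable_consSeq.comp (measurable_fst.fst.fst.prodMk measurable_fst.snd)).prodMk
      (measurable_consSeq.comp (measurable_fst.fst.snd.prodMk measurable_snd)))
  have hmF1 := hmF.lintegral_prod_right' (ν := iidLaw uniformCircle)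
  have hmF2 := hmF1.lintegral_prod_right' (ν := iidLaw (expMeasure lam))
  have hmF3 := hmF2.lintegral_prod_right' (ν := uniformCircle)
  calc
    _ = ∫⁻ s, (∫⁻ τ, (∫⁻ x, (∫⁻ v, (exactJumps (n + 1) t).indicator
          (fun τ => f (position c (n + 1) t (consSeq x v) τ)) (consSeq s τ)
          ∂iidLaw uniformCircle) ∂uniformCircle) ∂iidLaw (expMeasure lam)) ∂expMeasure lam := by
      rw [flightExpectation, lintegral_iidLaw _ hmG.lintegral_prod_right']
      refine lintegral_congr fun s => lintegral_congr fun τ => ?_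
      exact lintegral_iidLaw _ (hmG.comp (measurable_const.prodMk measurable_id))
    _ = ∫⁻ s, (∫⁻ x, (∫⁻ τ, (∫⁻ v, (exactJumps (n + 1) t).indicator
          (fun τ => f (position c (n + 1) t (consSeq x v) τ)) (consSeq s τ)
          ∂iidLaw uniformCircle) ∂iidLaw (expMeasure lam)) ∂uniformCircle) ∂expMeasure lam := by
      refine lintegral_congr fun s => lintegral_lintegral_swap ?_
      exact (hmF1.comp (f := fun p : (ℕ → ℝ) × Plane => ((s, p.2), p.1))
        (by fun_prop)).aemeasurable
    _ = ∫⁻ s in Ioi 0, ENNReal.ofReal (lam * exp (-(lam * s))) *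
          ∫⁻ x, (∫⁻ τ, (∫⁻ v, (exactJumps (n + 1) t).indicator
          (fun τ => f (position c (n + 1) t (consSeq x v) τ)) (consSeq s τ)
          ∂iidLaw uniformCircle) ∂iidLaw (expMeasure lam)) ∂uniformCircle :=
      lintegral_expMeasure lam hmF3
    _ = ∫⁻ s in Ioi 0, (Iic t).indicator (fun s => ENNReal.ofReal (lam * exp (-(lam * s))) *
        ∫⁻ x, flightExpectation lam c n (t - s) (fun y => f ((c * s) • x + y))
          ∂uniformCircle) s := by
      refine setLIntegral_congr_fun measurableSet_Ioi fun s (hs : 0 < s) => ?_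
      have hind : ∀ τ v x, (exactJumps (n + 1) t).indicator
          (fun τ => f (position c (n + 1) t (consSeq x v) τ)) (consSeq s τ)
          = (exactJumps n (t - s)).indicator
            (fun τ => f ((c * s) • x + position c n (t - s) v τ)) τ := by
        intro τ v x
        by_cases h : τ ∈ exactJumps n (t - s)
        · rw [indicator_of_mem h, indicator_of_mem (consSeq_mem_exactJumps_succ.2 ⟨hs, h⟩),
            position_consSeq]
        · rw [indicator_of_notMem h,
            indicator_of_notMem fun h' => h (consSeq_mem_exactJumps_succ.1 h').2]
      simp_rw [hind]
      by_cases hst : s ≤ t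
      · rw [indicator_of_mem (mem_Iic.2 hst)]
        rfl
      · have hempty : ∀ τ, τ ∉ exactJumps n (t - s) := fun τ hτ =>
          hst (sub_nonneg.1 (nonneg_of_mem_exactJumps hτ))
        simp [hempty, hst]
    _ = _ := by
      rw [setLIntegral_indicator measurableSet_Iic, Iic_inter_Ioi, setLIntegral_congr Ioo_ae_eq_Ioc]

/-! ### The law of the free flight -/

open scoped Nat

/-- The renewal equation with the factors `lam * exp (-lam * s)` and `exp (-lam * (t - s))` multiplied
together, and with the length `a = c * s` of the first displacement as the variable. -/
theorem flightExpectation_succ_of_forall {lam c : ℝ} (hlam : 0 < lam) (hc : 0 < c) {n : ℕ} {t : ℝ}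
    {f : Plane → ℝ≥0∞} (hf : Measurable f) {K : ℝ} (hK : 0 ≤ K) {G : ℝ → Plane → ℝ≥0∞}
    (h : ∀ s ∈ Ioo 0 t, ∀ x, flightExpectation lam c n (t - s) (fun y => f ((c * s) • x + y))
      = ENNReal.ofReal (K * exp (-lam * (t - s))) * G (c * s) x) :
    flightExpectation lam c (n + 1) t f = ENNReal.ofReal (lam / c * K * exp (-lam * t)) *
      ∫⁻ a in Ioo 0 (c * t), ∫⁻ x, G a x ∂uniformCircle := by
  rw [flightExpectation_succ hlam c n t hf]
  calc
    _ = ∫⁻ s in Ioo 0 t, ENNReal.ofReal (lam * K * exp (-lam * t)) *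
        ∫⁻ x, G (c * s) x ∂uniformCircle := by
      refine setLIntegral_congr_fun measurableSet_Ioo fun s hs => ?_
      simp_rw [h s hs]
      rw [lintegral_const_mul' _ _ ENNReal.ofReal_ne_top, ← mul_assoc,
        ← ENNReal.ofReal_mul (by positivity)]
      congr 2
      rw [show -lam * t = -(lam * s) + -lam * (t - s) by ring, exp_add]
      ring
    _ = _ := by
      have h2 := setLIntegral_comp_mul_add hc 0 (Ioo 0 (c * t))
        fun a => ∫⁻ x, G a x ∂uniformCircle
      have hpre : (fun x : ℝ => c * x + 0) ⁻¹' Ioo 0 (c * t) = Ioo 0 t := by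
        ext x
        simp only [add_zero, mem_preimage, mem_Ioo, mul_lt_mul_iff_right₀ hc,
          mul_pos_iff_of_pos_left hc]
      rw [hpre] at h2
      simp only [add_zero] at h2
      rw [lintegral_const_mul' _ _ ENNReal.ofReal_ne_top, h2, ← mul_assoc,
        ← ENNReal.ofReal_mul (by positivity)]
      congr 2
      field_simp

/-- The density of the position on the event of `n + 1` changes of direction. -/
theorem flightExpectation_succ_eq {lam c : ℝ} (hlam : 0 < lam) (hc : 0 < c) (n : ℕ) {t : ℝ}
    (ht : 0 ≤ t) {f : Plane → ℝ≥0∞} (hf : Measurable f) :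
    flightExpectation lam c (n + 1) t f
      = ENNReal.ofReal ((lam / c) ^ (n + 1) / (n ! * (2 * π)) * exp (-lam * t)) *
        ∫⁻ x, f x * ENNReal.ofReal (profile n ((c * t) ^ 2 - ‖x‖ ^ 2)) := by
  induction n generalizing t f with
  | zero =>
    rw [flightExpectation_succ_of_forall hlam hc hf zero_le_one
      (G := fun a x => ∫⁻ w, f (a • x + (c * t - a) • w) ∂uniformCircle),
      lintegral_two_steps (by positivity) hf, ← mul_assoc, ← ENNReal.ofReal_mul (by positivity)]
    · congr 2
      simp
      field_simp
    · intro s hs x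
      rw [flightExpectation_zero hlam c (sub_nonneg.2 hs.2.le) (by fun_prop), one_mul,
        mul_sub c]
  | succ n ih =>
    rw [flightExpectation_succ_of_forall hlam hc hf
      (K := (lam / c) ^ (n + 1) / (n ! * (2 * π))) (by positivity)
      (G := fun a x => ∫⁻ y, f (a • x + y) *
        ENNReal.ofReal (profile n ((c * t - a) ^ 2 - ‖y‖ ^ 2))),
      lintegral_profile_step n (by positivity) hf, ← mul_assoc,
      ← ENNReal.ofReal_mul (by positivity)]
    · congr 2
      rw [Nat.factorial_succ, pow_succ (lam / c) (n + 1)]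
      push_cast
      field_simp
    · intro s hs x
      rw [ih (sub_nonneg.2 hs.2.le) (by fun_prop)]
      simp_rw [mul_sub c]

theorem measurable_indicator_norm {S : Set ℝ} (hS : MeasurableSet S) :
    Measurable ({y : Plane | ‖y‖ ∈ S}.indicator (1 : Plane → ℝ≥0∞)) :=
  measurable_one.indicator (measurable_norm hS)

/-- Here `S` is one of the two half-lines with end point `s`: for `s < c * t` neither the density nor
the mass on the circle of radius `c * t` charges the circle of radius `s`. -/
theorem flightExpectation_norm_mem {lam c : ℝ} (hlam : 0 < lam) (hc : 0 < c) (n : ℕ) {t s : ℝ}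
    (hs : 0 ≤ s) (hst : s < c * t) {S : Set ℝ} (hS : MeasurableSet S) (hsS : Ioi s ⊆ S)
    (hSs : S ⊆ Ici s) :
    flightExpectation lam c n t ({y : Plane | ‖y‖ ∈ S}.indicator 1)
      = ENNReal.ofReal (exp (-lam * t) *
        ((lam / c * √((c * t) ^ 2 - s ^ 2)) ^ n / n !)) := by
  have hct : 0 < c * t := hs.trans_lt hst
  have ht : 0 ≤ t := (pos_of_mul_pos_right hct hc.le).le
  have hm := measurable_indicator_norm hS
  cases n with
  | zero =>
    rw [flightExpectation_zero hlam c ht hm]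
    have : ∫⁻ v, ({y : Plane | ‖y‖ ∈ S}.indicator (1 : Plane → ℝ≥0∞)) ((c * t) • v) ∂uniformCircle
        = ∫⁻ _, 1 ∂uniformCircle := by
      refine lintegral_congr_ae ?_
      filter_upwards [ae_norm_eq_one_uniformCircle] with v hv
      rw [indicator_of_mem, Pi.one_apply]
      rw [mem_ofPred_eq, norm_smul, hv, mul_one, norm_eq_abs, abs_of_pos hct]
      exact hsS hst
    simp [this]
  | succ n =>
    rw [flightExpectation_succ_eq hlam hc n ht hm]
    have h1 : ∫⁻ x, ({y : Plane | ‖y‖ ∈ S}.indicator (1 : Plane → ℝ≥0∞)) x *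
        ENNReal.ofReal (profile n ((c * t) ^ 2 - ‖x‖ ^ 2))
        = ∫⁻ x in {y : Plane | s < ‖y‖},
          ENNReal.ofReal (profile n ((c * t) ^ 2 - ‖x‖ ^ 2)) := by
      have hae : ({y : Plane | s < ‖y‖} : Set Plane) =ᵐ[volume] {y : Plane | ‖y‖ ∈ S} := by
        have h0 : volume (Metric.sphere (0 : Plane) s) = 0 := Measure.addHaar_sphere _ _ _
        refine Filter.eventuallyEq_set.2 ?_
        filter_upwards [measure_eq_zero_iff_ae_notMem.1 h0] with y hy
        rw [mem_sphere_zero_iff_norm] at hy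
        exact ⟨fun h => hsS h, fun h => lt_of_le_of_ne (hSs h) (Ne.symm hy)⟩
      rw [setLIntegral_congr hae, ← lintegral_indicator
        (show MeasurableSet {y : Plane | ‖y‖ ∈ S} from measurable_norm hS)]
      refine lintegral_congr fun x => ?_
      by_cases hx : x ∈ {y : Plane | ‖y‖ ∈ S}
      · rw [indicator_of_mem hx, indicator_of_mem (by exact hx), Pi.one_apply, one_mul]
      · rw [indicator_of_notMem hx, indicator_of_notMem (by exact hx), zero_mul]
    rw [h1, setLIntegral_profile_radial n hs, ← ENNReal.ofReal_mul (by positivity)]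
    congr 1
    rw [Nat.factorial_succ, mul_pow (lam / c)]
    push_cast
    field_simp

theorem tsum_flightExpectation_norm_mem {lam c : ℝ} (hlam : 0 < lam) (hc : 0 < c) {t s : ℝ}
    (hs : 0 ≤ s) (hst : s < c * t) {S : Set ℝ} (hS : MeasurableSet S) (hsS : Ioi s ⊆ S)
    (hSs : S ⊆ Ici s) :
    ∑' n, flightExpectation lam c n t ({y : Plane | ‖y‖ ∈ S}.indicator 1)
      = ENNReal.ofReal (exp (-lam * t + lam / c * √((c * t) ^ 2 - s ^ 2))) := by
  simp_rw [flightExpectation_norm_mem hlam hc _ hs hst hS hsS hSs]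
  have h := (NormedSpace.expSeries_div_hasSum_exp (𝔸 := ℝ)
    (lam / c * √((c * t) ^ 2 - s ^ 2))).mul_left (exp (-lam * t))
  rw [← ENNReal.ofReal_tsum_of_nonneg (fun n => by positivity) h.summable, h.tsum_eq,
    ← Real.exp_eq_exp_ℝ, ← exp_add]

theorem flightExpectation_eq_zero_of_le {lam c : ℝ} (hlam : 0 < lam) (hc : 0 < c) (n : ℕ) {t s : ℝ}
    (ht : 0 ≤ t) (hst : c * t ≤ s) :
    flightExpectation lam c n t ({y : Plane | ‖y‖ ∈ Ioi s}.indicator 1) = 0 := by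
  have hm := measurable_indicator_norm (measurableSet_Ioi (a := s))
  have hct : 0 ≤ c * t := by positivity
  cases n with
  | zero =>
    rw [flightExpectation_zero hlam c ht hm, lintegral_congr_ae (g := 0), Pi.zero_def,
      lintegral_zero, mul_zero]
    filter_upwards [ae_norm_eq_one_uniformCircle] with v hv
    refine indicator_of_notMem ?_ _
    rw [mem_ofPred_eq, norm_smul, hv, mul_one, norm_eq_abs, abs_of_nonneg hct]
    exact not_lt.2 hst
  | succ n =>
    rw [flightExpectation_succ_eq hlam hc n ht hm, lintegral_congr (g := fun _ => 0),
      lintegral_zero, mul_zero]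
    intro x
    by_cases hx : s < ‖x‖
    · rw [profile_of_nonpos, ENNReal.ofReal_zero, mul_zero]
      nlinarith
    · rw [indicator_of_notMem (by exact hx), zero_mul]

/-! ### From sequences to the flight, and reflection -/

theorem jumpTime_lt_jumpTime {τ : ℕ → ℝ} (hτ : ∀ k, 0 < τ k) {m n : ℕ} :
    jumpTime τ m < jumpTime τ n ↔ m < n :=
  (strictMono_nat_of_lt_succ fun n => by
    rw [jumpTime, jumpTime, Finset.sum_range_succ]; linarith [hτ n] :
      StrictMono (jumpTime τ)).lt_iff_lt

theorem le_of_mem_exactJumps {t : ℝ} {τ : ℕ → ℝ} {m n : ℕ} (h : τ ∈ exactJumps n t)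
    (hm : jumpTime τ m ≤ t) : m ≤ n :=
  Nat.lt_succ_iff.1 ((jumpTime_lt_jumpTime h.1).1 (hm.trans_lt h.2.2))

theorem eq_of_mem_exactJumps {t : ℝ} {τ : ℕ → ℝ} {m n : ℕ} (hm : τ ∈ exactJumps m t)
    (hn : τ ∈ exactJumps n t) : m = n :=
  le_antisymm (le_of_mem_exactJumps hn hm.2.1) (le_of_mem_exactJumps hm hn.2.1)

section Bridge

variable {Ω : Type*} {τ : ℕ → Ω → ℝ} {V : ℕ → Ω → Plane} {ω : Ω} {n : ℕ} {t : ℝ}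

/-- On these sequences the supremum that defines `numChanges` is attained. -/
theorem numChanges_eq (h : (fun k => τ k ω) ∈ exactJumps n t) : numChanges τ t ω = n :=
  IsGreatest.csSup_eq ⟨h.2.1, fun _ hm => le_of_mem_exactJumps h hm⟩

theorem freeFlight_eq_position (c : ℝ) (h : (fun k => τ k ω) ∈ exactJumps n t) :
    freeFlight c V τ t ω = position c n t (fun k => V k ω) (fun k => τ k ω) := by
  rw [freeFlight, numChanges_eq h]
  rfl

end Bridge

/-- The pairs of sequences of directions and waiting times for which the distance from the origin at
time `t` lies in `S`. -/
def distanceEvent (c t : ℝ) (S : Set ℝ) : Set ((ℕ → Plane) × (ℕ → ℝ)) :=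
  ⋃ n, {p | p.2 ∈ exactJumps n t ∧ ‖position c n t p.1 p.2‖ ∈ S}

theorem measurableSet_distanceEvent_slice (c t : ℝ) (n : ℕ) {S : Set ℝ} (hS : MeasurableSet S) :
    MeasurableSet {p : (ℕ → Plane) × (ℕ → ℝ) |
      p.2 ∈ exactJumps n t ∧ ‖position c n t p.1 p.2‖ ∈ S} := by
  refine .inter (measurable_snd (measurableSet_exactJumps n t)) ?_
  have h : Measurable fun p : (ℕ → Plane) × (ℕ → ℝ) => ‖position c n t p.1 p.2‖ := by
    unfold position jumpTime
    fun_prop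
  exact h hS

theorem measurableSet_distanceEvent (c t : ℝ) {S : Set ℝ} (hS : MeasurableSet S) :
    MeasurableSet (distanceEvent c t S) :=
  .iUnion fun n => measurableSet_distanceEvent_slice c t n hS

theorem measure_distanceEvent {lam : ℝ} (hlam : 0 < lam) (c t : ℝ) {S : Set ℝ}
    (hS : MeasurableSet S) :
    ((iidLaw uniformCircle).prod (iidLaw (expMeasure lam))) (distanceEvent c t S)
      = ∑' n, flightExpectation lam c n t ({y : Plane | ‖y‖ ∈ S}.indicator 1) := by
  have := isProbabilityMeasure_expMeasure hlam
  rw [distanceEvent, measure_iUnion]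
  · refine tsum_congr fun n => ?_
    have hm := measurableSet_distanceEvent_slice c t n hS
    rw [← lintegral_indicator_one hm,
      lintegral_prod_symm _ (measurable_one.indicator hm).aemeasurable, flightExpectation]
    refine lintegral_congr fun τ => lintegral_congr fun v => ?_
    by_cases h1 : τ ∈ exactJumps n t <;> by_cases h2 : ‖position c n t v τ‖ ∈ S <;>
      simp [indicator, h1, h2]
  · intro m n hmn
    refine disjoint_left.2 fun p hp hp' => hmn (eq_of_mem_exactJumps hp.1 hp'.1)
  · exact fun n => measurableSet_distanceEvent_slice c t n hS

theorem IsPoissonFlight.ae_norm_direction {Ω : Type*} [MeasurableSpace Ω] {P : Measure Ω} {lam : ℝ}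
    {V : ℕ → Ω → Plane} {τ : ℕ → Ω → ℝ} (h : IsPoissonFlight P lam V τ) (k : ℕ) :
    ∀ᵐ ω ∂P, ‖V k ω‖ = 1 := by
  have h1 := ae_norm_eq_one_uniformCircle
  rw [← (h.hasLaw_direction k).map_eq] at h1
  exact ae_of_ae_map (h.hasLaw_direction k).aemeasurable h1

section Flight

variable {Ω : Type*} [MeasurableSpace Ω] {P : Measure Ω} [IsProbabilityMeasure P]
  {c lam t : ℝ} {V : ℕ → Ω → Plane} {τ : ℕ → Ω → ℝ}

theorem IsPoissonFlight.hasLaw (h : IsPoissonFlight P lam V τ) :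
    HasLaw (fun ω => ((fun k => V k ω), (fun k => τ k ω)))
      ((iidLaw uniformCircle).prod (iidLaw (expMeasure lam))) P :=
  h.indepFun.hasLaw_prod
    (h.iIndepFun_direction.hasLaw_infinitePi h.hasLaw_direction
      (aemeasurable_pi_iff.2 fun k => (h.hasLaw_direction k).aemeasurable))
    (h.iIndepFun_time.hasLaw_infinitePi h.hasLaw_time
      (aemeasurable_pi_iff.2 fun k => (h.hasLaw_time k).aemeasurable))

theorem IsPoissonFlight.measure_distanceEvent (h : IsPoissonFlight P lam V τ) (hlam : 0 < lam)
    (c t : ℝ) {S : Set ℝ} (hS : MeasurableSet S) :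
    P {ω | ((fun k => V k ω), (fun k => τ k ω)) ∈ distanceEvent c t S}
      = ∑' n, flightExpectation lam c n t ({y : Plane | ‖y‖ ∈ S}.indicator 1) := by
  rw [← RandomFlight.measure_distanceEvent hlam c t hS]
  exact h.hasLaw.measure_eq (measurableSet_distanceEvent c t hS)

/-- The events of exactly `n` changes of direction exhaust the probability space, because their
probabilities are Poisson weights. -/
theorem IsPoissonFlight.ae_exists_exactJumps (h : IsPoissonFlight P lam V τ) (hlam : 0 < lam)
    (ht : 0 < t) : ∀ᵐ ω ∂P, ∃ n, (fun k => τ k ω) ∈ exactJumps n t := by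
  -- The set `Ici 0` imposes no condition on the distance, and the speed is immaterial.
  have h1 : P {ω | ((fun k => V k ω), (fun k => τ k ω)) ∈ distanceEvent 1 t (Ici 0)} = 1 := by
    rw [h.measure_distanceEvent hlam 1 t measurableSet_Ici,
      tsum_flightExpectation_norm_mem hlam one_pos le_rfl (by simpa) measurableSet_Ici
        Ioi_subset_Ici_self le_rfl]
    rw [one_mul, div_one, zero_pow two_ne_zero, sub_zero, sqrt_sq ht.le]
    simp
  have h2 : NullMeasurableSet
      {ω | ((fun k => V k ω), (fun k => τ k ω)) ∈ distanceEvent 1 t (Ici 0)} P :=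
    h.hasLaw.aemeasurable.nullMeasurable (measurableSet_distanceEvent 1 t measurableSet_Ici)
  filter_upwards [(prob_compl_eq_zero_iff₀ h2).2 h1] with ω hω
  obtain ⟨n, hn⟩ := mem_iUnion.1 hω
  exact ⟨n, hn.1⟩

theorem IsPoissonFlight.distanceEvent_ae_eq (h : IsPoissonFlight P lam V τ) (hlam : 0 < lam)
    (ht : 0 < t) (c : ℝ) (S : Set ℝ) :
    {ω | ((fun k => V k ω), (fun k => τ k ω)) ∈ distanceEvent c t S}
      =ᵐ[P] {ω | ‖freeFlight c V τ t ω‖ ∈ S} := by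
  refine Filter.eventuallyEq_set.2 ?_
  filter_upwards [h.ae_exists_exactJumps hlam ht] with ω ⟨n, hn⟩
  simp only [mem_ofPred_eq, distanceEvent, mem_iUnion, freeFlight_eq_position c hn]
  refine ⟨fun ⟨m, hm, hmS⟩ => ?_, fun hS => ⟨n, hn, hS⟩⟩
  rwa [← eq_of_mem_exactJumps hm hn]

theorem IsPoissonFlight.nullMeasurableSet_norm_mem (h : IsPoissonFlight P lam V τ) (hlam : 0 < lam)
    (ht : 0 < t) (c : ℝ) {S : Set ℝ} (hS : MeasurableSet S) :
    NullMeasurableSet {ω | ‖freeFlight c V τ t ω‖ ∈ S} P :=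
  NullMeasurableSet.congr
    (h.hasLaw.aemeasurable.nullMeasurable (measurableSet_distanceEvent c t hS))
    (h.distanceEvent_ae_eq hlam ht c S)

/-- The tail of the distance of the free flight from the origin. The set `S` is one of the two
half-lines with end point `s`. -/
theorem IsPoissonFlight.measureReal_norm_freeFlight (h : IsPoissonFlight P lam V τ) (hlam : 0 < lam)
    (hc : 0 < c) {s : ℝ} (hs : 0 ≤ s) (hst : s < c * t) {S : Set ℝ} (hS : MeasurableSet S)
    (hsS : Ioi s ⊆ S) (hSs : S ⊆ Ici s) :
    P.real {ω | ‖freeFlight c V τ t ω‖ ∈ S}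
      = exp (-lam * t + lam / c * √(c ^ 2 * t ^ 2 - s ^ 2)) := by
  have ht : 0 < t := pos_of_mul_pos_right (hs.trans_lt hst) hc.le
  rw [← measureReal_congr (h.distanceEvent_ae_eq hlam ht c S), measureReal_def,
    h.measure_distanceEvent hlam c t hS, tsum_flightExpectation_norm_mem hlam hc hs hst hS hsS hSs,
    ENNReal.toReal_ofReal (exp_pos _).le, mul_pow]

theorem IsPoissonFlight.measure_norm_freeFlight_eq_zero (h : IsPoissonFlight P lam V τ)
    (hlam : 0 < lam) (hc : 0 < c) (ht : 0 < t) {s : ℝ} (hst : c * t ≤ s) :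
    P {ω | ‖freeFlight c V τ t ω‖ ∈ Ioi s} = 0 := by
  rw [← measure_congr (h.distanceEvent_ae_eq hlam ht c (Ioi s)),
    h.measure_distanceEvent hlam c t measurableSet_Ioi]
  exact ENNReal.tsum_eq_zero.2 fun n => flightExpectation_eq_zero_of_le hlam hc n ht.le hst

/-- Almost surely the reflected flight is at distance less than `r` exactly when the free flight is
either at distance less than `r` or at distance more than `R ^ 2 / r`. -/
theorem IsPoissonFlight.reflectedDistance_lt_ae_eq (h : IsPoissonFlight P lam V τ)
    (hlam : 0 < lam) (hc : 0 < c) {R r : ℝ} (hR : 0 < R) (ht : R / c < t) (hr : 0 < r)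
    (hrR : r ≤ R) :
    {ω | reflectedDistance c R V τ t ω < r} =ᵐ[P]
      ({ω | ‖freeFlight c V τ t ω‖ ∈ Ici r}ᶜ ∪ {ω | ‖freeFlight c V τ t ω‖ ∈ Ioi (R ^ 2 / r)} :
        Set Ω) := by
  have ht0 : 0 < t := (div_pos hR hc).trans ht
  have hRct : R < c * t := by rwa [div_lt_iff₀' hc] at ht
  have hle : ∀ᵐ ω ∂P, ‖freeFlight c V τ t ω‖ ≤ c * t := by
    filter_upwards [measure_eq_zero_iff_ae_notMem.1
      (h.measure_norm_freeFlight_eq_zero hlam hc ht0 le_rfl)] with ω hω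
    exact not_lt.1 hω
  refine Filter.eventuallyEq_set.2 ?_
  filter_upwards [hle, h.ae_norm_direction 0] with ω hω hV
  simp only [mem_union, mem_compl_iff, mem_ofPred_eq, mem_Ici, mem_Ioi, not_le]
  have hRr : R ≤ R ^ 2 / r := by
    rw [le_div_iff₀ hr]
    nlinarith
  -- At distance at least `R` only the inverted position counts.
  have hinv : R ≤ ‖freeFlight c V τ t ω‖ →
      (‖EuclideanGeometry.inversion (0 : Plane) R (freeFlight c V τ t ω)‖ < r ↔
        ‖freeFlight c V τ t ω‖ < r ∨ R ^ 2 / r < ‖freeFlight c V τ t ω‖) := by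
    intro hX
    rw [← dist_zero_right, EuclideanGeometry.dist_inversion_center, dist_zero_right,
      div_lt_iff₀ (hR.trans_le hX), div_lt_iff₀ hr, mul_comm r]
    exact ⟨Or.inr, fun h => h.resolve_left (not_lt.2 (hrR.trans hX))⟩
  rw [reflectedDistance, reflectedFlight, if_neg (not_le.2 ht)]
  split_ifs with hN
  · have hX : ‖freeFlight c V τ t ω‖ = c * t := by
      rw [freeFlight, hN]
      simp [changeTime, norm_smul, hV, abs_of_pos hc, abs_of_pos ht0]
    rw [indicator_of_mem (mem_sphere_zero_iff_norm.2 hX)]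
    exact hinv (hX ▸ hRct.le)
  · rcases lt_or_ge ‖freeFlight c V τ t ω‖ R with hX | hX
    · rw [indicator_of_mem (mem_ball_zero_iff.2 hX), indicator_of_notMem (fun h' => hX.not_ge h'.1),
        add_zero, id]
      exact ⟨Or.inl, fun h' => h'.resolve_right (not_lt.2 (hX.le.trans hRr))⟩
    · rw [indicator_of_notMem (fun h' => hX.not_gt (mem_ball_zero_iff.1 h')),
        indicator_of_mem (show freeFlight c V τ t ω ∈ {x : Plane | R ≤ ‖x‖ ∧ ‖x‖ ≤ c * t} from
          ⟨hX, hω⟩), zero_add]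
      exact hinv hX

end Flight

end RandomFlight

theorem mainTheorem3 {Ω : Type*} [MeasurableSpace Ω] (P : Measure Ω) [IsProbabilityMeasure P]
    (c lam R : ℝ) (hc : 0 < c) (hlam : 0 < lam) (hR : 0 < R)
    (V : ℕ → Ω → RandomFlight.Plane) (τ : ℕ → Ω → ℝ)
    (hflight : RandomFlight.IsPoissonFlight P lam V τ)
    (t : ℝ) (ht : R / c < t) (r : ℝ) (hr : 0 < r) (hrR : r ≤ R) :
    P.real {ω | RandomFlight.reflectedDistance c R V τ t ω < r} =
      (1 - Real.exp (-lam * t + lam / c * √(c ^ 2 * t ^ 2 - r ^ 2)))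
        + (if R ^ 2 / (c * t) < r then
            Real.exp (-lam * t + lam / c * √(c ^ 2 * t ^ 2 - R ^ 4 / r ^ 2))
          else 0) := by
  have ht0 : 0 < t := (div_pos hR hc).trans ht
  have hRct : R < c * t := by rwa [div_lt_iff₀' hc] at ht
  have hRr : r ≤ R ^ 2 / r := by
    rw [le_div_iff₀ hr]
    nlinarith
  have hdisj : Disjoint {ω | ‖RandomFlight.freeFlight c V τ t ω‖ ∈ Set.Ici r}ᶜ
      {ω | ‖RandomFlight.freeFlight c V τ t ω‖ ∈ Set.Ioi (R ^ 2 / r)} :=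
    Set.disjoint_compl_left_iff_subset.2 fun ω hω => hRr.trans (le_of_lt hω)
  rw [measureReal_congr (hflight.reflectedDistance_lt_ae_eq hlam hc hR ht hr hrR),
    measureReal_union₀ (hflight.nullMeasurableSet_norm_mem hlam ht0 c measurableSet_Ioi)
      hdisj.aedisjoint,
    probReal_compl_eq_one_sub₀ (hflight.nullMeasurableSet_norm_mem hlam ht0 c measurableSet_Ici),
    hflight.measureReal_norm_freeFlight hlam hc hr.le (hrR.trans_lt hRct) measurableSet_Ici
      Set.Ioi_subset_Ici_self le_rfl]
  congr 1
  split_ifs with hlt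
  · have hlt' : R ^ 2 / r < c * t := by
      rw [div_lt_iff₀ (by positivity)] at hlt
      rw [div_lt_iff₀ hr]
      linarith
    rw [hflight.measureReal_norm_freeFlight hlam hc (by positivity) hlt' measurableSet_Ioi
      le_rfl Set.Ioi_subset_Ici_self]
    ring_nf
  · have hle : c * t ≤ R ^ 2 / r := by
      rw [not_lt, le_div_iff₀ (by positivity)] at hlt
      rw [le_div_iff₀ hr]
      linarith
    rw [measureReal_def, hflight.measure_norm_freeFlight_eq_zero hlam hc ht0 hle,
      ENNReal.toReal_zero]
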